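/- Let $q\in(0,1)$, let $a\neq 0$ and $b$ be real numbers with $b<0$ and $|b|>|a|$, and put $$\kappa:=-\frac{\log|b/a|}{\log(1/q)}<0 .$$ Let $f:[0,\infty)\to\mathbb{R}$ be continuous, let $x$ be the continuous solution of $x'(t)=ax(qt)+bx(t)+f(t)$, $t\ge 0$, with arbitrary initial value $x(0)\in\mathbb{R}$, and let $y$ be the solution of $y'(t)=-y(t)+f(t)$, $t\ge0$, $y(0)=0$. Let $\theta$ be a real function such that $|\theta(t)|$ is non-decreasing for large $t$, $|\theta(t)|\to\infty$ and $\theta(t)/\log t\to\eta\in[\kappa,\infty]$ as $t\to\infty$. All upper limits are taken in $[-\infty,\infty]$ with $\log 0=-\infty$. (A) If $\eta=\kappa$ (so that $\theta(t)\to-\infty$), then $$\limsup_{t\to\infty}\frac{\log|y(t)|}{|\theta(t)|}\le -1\iff \limsup_{t\to\infty}\frac{\log|x(t)|}{|\theta(t)|}\le -1,$$ and $$\limsup_{t\to\infty}\frac{\log|y(t)|}{\log t}\le \kappa\iff \limsup_{t\to\infty}\frac{\log|x(t)|}{\log t}\le \kappa .$$ (B) Let $\eta\in(\kappa,\infty]$.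 (i) If $\theta(t)\to+\infty$, then $$\limsup_{t\to\infty}\frac{\log|y(t)|}{\theta(t)}=1\iff \limsup_{t\to\infty}\frac{\log|x(t)|}{\theta(t)}=1 .$$ (ii) If $\theta(t)\to-\infty$ and, in the case $\eta=0$ only, $e^{\theta}$ is moreover slowly varying at infinity (that is, $e^{\theta(ct)-\theta(t)}\to1$ as $t\to\infty$ for every $c>0$), then $$\limsup_{t\to\infty}\frac{\log|y(t)|}{|\theta(t)|}=-1\iff \limsup_{t\to\infty}\frac{\log|x(t)|}{|\theta(t)|}=-1 .$$ (iii) If $\eta<\infty$, then $$\limsup_{t\to\infty}\frac{\log|y(t)|}{\log t}=\eta\iff \limsup_{t\to\infty}\frac{\log|x(t)|}{\log t}=\eta .$$ -/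

import Mathlib

open Filter Topology Set

noncomputable section

/-- `x` is a (continuously differentiable) solution on `[0,∞)` of the forced pantograph equation
`x'(t) = a x(qt) + b x(t) + f(t)`; the initial value `x(0)` is arbitrary. At `t = 0` the
derivative is one-sided. -/
def IsPantographSolution (a b q : ℝ) (f x : ℝ → ℝ) : Prop :=
  ∀ t : ℝ, 0 ≤ t → HasDerivWithinAt x (a * x (q * t) + b * x t + f t) (Ici 0) t

/-- `y` is the solution on `[0,∞)` of `y'(t) = -y(t) + f(t)`, `y(0) = 0`. -/
def IsAuxiliarySolution (f y : ℝ → ℝ) : Prop :=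
  y 0 = 0 ∧ ∀ t : ℝ, 0 ≤ t → HasDerivWithinAt y (-y t + f t) (Ici 0) t

/-- The critical exponent `κ = -log |b/a| / log (1/q)`. -/
def pantographKappa (a b q : ℝ) : ℝ :=
  -(Real.log |b / a|) / Real.log (1 / q)

/-- `limsup_{t → ∞} log |v(t)| / w(t)` in `[-∞,∞]`, with the convention `log 0 = -∞`. -/
def logLimsup (v w : ℝ → ℝ) : EReal :=
  limsup (fun t : ℝ => ENNReal.log (ENNReal.ofReal |v t|) / ((w t : ℝ) : EReal)) atTop

/-- `g` is slowly varying at infinity (regularly varying with index `0`). It is only used for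
functions that are monotone near infinity, for which measurability near infinity is automatic. -/
def IsSlowlyVarying (g : ℝ → ℝ) : Prop :=
  (∀ᶠ t in atTop, 0 < g t) ∧
    ∀ c : ℝ, 0 < c → Tendsto (fun t => g (c * t) / g t) atTop (𝓝 1)

end

/-! The difference `x - y` solves the pantograph equation driven by `y`, while `y - x` solves `w' =
-w` driven by `x`, itself a pantograph equation with `a = 0`, `b = -1`. One estimate therefore
transfers growth bounds in both directions.

The estimate (`IsDrivenPantograph.eventually_abs_le`) says that a forcing of size `O(S)` produces a
solution of size `O(S)` whenever `S(t) / t ^ c` is almost increasing for some `c` with `|a| q ^ c <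
|b|`, that is `c > κ`. It comes from comparison with the supersolution `N t ^ c`.

Taking `S = exp (p W)` shows that `y` and `x` satisfy the same bounds `limsup ≤ p` at every real
level `p` above a threshold. This gives the equivalence of `limsup ≤ p₀` at the threshold and of
`limsup = L` at each `L` above it. The admissible weights are powers (`W = log`), increasing
functions, and slowly varying functions via a Potter bound. When `η` is finite and negative, `|θ|`
is asymptotic to a multiple of `log`, so the weight can be replaced by `log`. -/

/-- `w` solves `w'(t) = a w(qt) + b w(t) + A v(qt) + B v(t)` for `t ≥ 0`. -/
def IsDrivenPantograph (a b q A B : ℝ) (v w : ℝ → ℝ) : Prop :=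
  ∀ t : ℝ, 0 ≤ t →
    HasDerivWithinAt w (a * w (q * t) + b * w t + (A * v (q * t) + B * v t)) (Ici 0) t

/-- `S(t) / t ^ c` is almost increasing: it is non-decreasing up to a constant factor. -/
def AlmostIncreasing (S : ℝ → ℝ) (c : ℝ) : Prop :=
  ∃ T C : ℝ, 0 < T ∧ 0 < C ∧ ∀ u t, T ≤ u → u ≤ t → S u * u ^ (-c) ≤ C * (S t * t ^ (-c))

/-! ### Comparison principle and growth estimates for the driven equation. -/

lemma deriv_nonpos_of_pos_left {D : ℝ → ℝ} {D' l t : ℝ} (hlt : l < t) (h : HasDerivAt D D' t)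
    (hpos : ∀ s ∈ Ioo l t, 0 < D s) (h0 : D t ≤ 0) : D' ≤ 0 := by
  have hs := (hasDerivWithinAt_iff_tendsto_slope' (by simp)).1 (h.hasDerivWithinAt (s := Iio t))
  refine le_of_tendsto hs ?_
  filter_upwards [Ioo_mem_nhdsLT hlt] with s hs
  rw [slope_def_field]
  exact div_nonpos_of_nonneg_of_nonpos (by linarith [hpos s hs]) (by linarith [hs.2])

lemma abs_lt_of_strict_supersolution {a b q T T' : ℝ} {g w V V' : ℝ → ℝ}
    (hq0 : 0 < q) (hq1 : q < 1) (hb : b < 0) (hT : 0 < T)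
    (hw : ∀ t, 0 ≤ t → HasDerivWithinAt w (a * w (q * t) + b * w t + g t) (Ici 0) t)
    (hV : ∀ t, 0 < t → HasDerivAt V (V' t) t)
    (hsup : ∀ t ∈ Icc T T', |a| * V (q * t) + b * V t + |g t| < V' t)
    (hinit : ∀ t ∈ Icc (q * T) T, |w t| < V t) :
    ∀ t ∈ Icc T T', |w t| < V t := by
  by_contra! hcon
  have hqT : 0 < q * T := by positivity
  have hwc : ContinuousOn w (Ici 0) := fun t ht => (hw t ht).continuousWithinAt
  have hVc : ContinuousOn V (Icc T T') := fun t ht =>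
    (hV t (hT.trans_le ht.1)).continuousAt.continuousWithinAt
  have hwc' : ContinuousOn w (Icc T T') := hwc.mono fun t ht => hT.le.trans ht.1
  have hK : IsCompact (Icc T T' ∩ {t | V t ≤ |w t|}) := by
    have : IsClosed (Icc T T' ∩ {t | V t ≤ |w t|}) :=
      isClosed_Icc.isClosed_le hVc hwc'.abs
    exact isCompact_Icc.of_isClosed_subset this inter_subset_left
  -- First contact time of `|w|` with `V`. Since `q * t₁ < t₁`, the delayed value is still strictly
  -- below the barrier.
  obtain ⟨t₁, ⟨ht₁, hle⟩, hmin⟩ := hK.exists_isLeast (by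
    obtain ⟨t, h1, h2⟩ := hcon
    exact ⟨t, h1, h2⟩)
  have hT₁ : T < t₁ := by
    rcases ht₁.1.lt_or_eq with h | h
    · exact h
    · have := hinit T ⟨by nlinarith, le_rfl⟩
      rw [h] at this
      exact absurd this (not_lt.2 hle)
  have hbefore : ∀ s, q * T ≤ s → s < t₁ → |w s| < V s := by
    intro s h1 h2
    rcases le_total s T with h | h
    · exact hinit s ⟨h1, h⟩
    · by_contra! h3
      exact absurd (hmin ⟨⟨h, h2.le.trans ht₁.2⟩, h3⟩) (not_le.2 h2)
  have ht₁0 : 0 < t₁ := hT.trans hT₁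
  have hwd := (hw t₁ ht₁0.le).hasDerivAt (Ici_mem_nhds ht₁0)
  have hq := hbefore (q * t₁) (by nlinarith) (by nlinarith)
  have hs := hsup t₁ ht₁
  have haw : |a * w (q * t₁)| ≤ |a| * V (q * t₁) := by
    rw [abs_mul]
    exact mul_le_mul_of_nonneg_left hq.le (abs_nonneg a)
  have hg := abs_le.1 (le_refl |g t₁|)
  have haw' := abs_le.1 haw
  have hle' : V t₁ ≤ |w t₁| := hle
  -- Whichever of `V - w`, `V + w` is nonpositive at `t₁` was positive before, so its derivative
  -- there is `≤ 0`; the strict differential inequality makes it positive.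
  rcases le_abs.1 hle' with h | h
  · have := deriv_nonpos_of_pos_left hT₁ ((hV t₁ ht₁0).sub hwd)
      (fun s hs => by
        have := (abs_lt.1 (hbefore s (by nlinarith [hs.1]) hs.2)).2
        simp only [Pi.sub_apply]; linarith) (by simp only [Pi.sub_apply]; linarith)
    nlinarith
  · have := deriv_nonpos_of_pos_left hT₁ ((hV t₁ ht₁0).add hwd)
      (fun s hs => by
        have := (abs_lt.1 (hbefore s (by nlinarith [hs.1]) hs.2)).1
        simp only [Pi.add_apply]; linarith) (by simp only [Pi.add_apply]; linarith)
    nlinarith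

/-- A solution of the pantograph equation is dominated by `t ^ c` when the forcing is, provided
that `|a| q ^ c < |b|`. -/
lemma exists_pantograph_rpow_bound {a b q c : ℝ} (hq0 : 0 < q) (hq1 : q < 1) (hb : b < 0)
    (hc : |a| * q ^ c < -b) :
    ∃ T₀ K : ℝ, 0 < T₀ ∧ 0 < K ∧ ∀ (g w : ℝ → ℝ) (T T' M : ℝ), T₀ ≤ T → T ≤ T' → 0 < M →
      (∀ t, 0 ≤ t → HasDerivWithinAt w (a * w (q * t) + b * w t + g t) (Ici 0) t) →
      (∀ t ∈ Icc T T', |g t| ≤ M * t ^ c) → (∀ t ∈ Icc (q * T) T, |w t| ≤ M * t ^ c) →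
      |w T'| ≤ K * M * T' ^ c := by
  obtain ⟨δ, hδ⟩ : ∃ δ, δ = -b - |a| * q ^ c := ⟨_, rfl⟩
  have hδ0 : 0 < δ := by linarith
  -- Beyond `T₀` one has `c / t ≥ -δ / 2`, so half of the damping `δ` survives differentiation of `t
  -- ^ c`. The factor `K` makes `δ N / 2` exceed `M` and also `N > M`.
  refine ⟨2 * |c| / δ + 1, 4 / δ + 2, by positivity, by positivity, ?_⟩
  intro g w T T' M hT hTT' hM hw hg hinit
  have hT0 : 0 < T := lt_of_lt_of_le (by positivity) hT
  have hN : 2 * M < δ * ((4 / δ + 2) * M) := by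
    have : δ * ((4 / δ + 2) * M) = 4 * M + 2 * δ * M := by field_simp
    rw [this]; nlinarith [mul_pos hδ0 hM]
  have hMN : M < (4 / δ + 2) * M := by
    have : 0 < 4 / δ := by positivity
    nlinarith
  obtain ⟨N, hNdef⟩ : ∃ N, N = (4 / δ + 2) * M := ⟨_, rfl⟩
  rw [← hNdef] at hN hMN ⊢
  refine (abs_lt_of_strict_supersolution (V := fun t => N * t ^ c)
    (V' := fun t => N * (c * t ^ (c - 1))) hq0 hq1 hb hT0 hw ?_ ?_ ?_ T' ⟨hTT', le_rfl⟩).le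
  · intro t ht
    exact (Real.hasDerivAt_rpow_const (Or.inl ht.ne')).const_mul N
  · intro t ht
    have ht0 : 0 < t := hT0.trans_le ht.1
    have htc : 0 < t ^ c := Real.rpow_pos_of_pos ht0 c
    have h1 : t ^ (c - 1) = t ^ c / t := Real.rpow_sub_one ht0.ne' c
    have h2 : (q * t) ^ c = q ^ c * t ^ c := Real.mul_rpow hq0.le ht0.le
    have h3 : -(δ / 2) ≤ c / t := by
      have h4 : 2 * |c| / δ ≤ t := by linarith [ht.1]
      rw [div_le_iff₀ hδ0] at h4
      rw [le_div_iff₀ ht0]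
      linarith [neg_abs_le c]
    have h5 : N * (c * t ^ (c - 1)) = N * t ^ c * (c / t) := by rw [h1]; ring
    have h6 : |a| * (N * (q * t) ^ c) + b * (N * t ^ c) = N * t ^ c * (-δ) := by
      rw [h2, hδ]; ring
    have h7 : N * t ^ c * (-(δ / 2)) ≤ N * t ^ c * (c / t) :=
      mul_le_mul_of_nonneg_left h3 (by nlinarith)
    have h8 := hg t ht
    have h9 := mul_lt_mul_of_pos_right hN htc
    rw [h5, h6]
    nlinarith
  · intro t ht
    have ht0 : 0 < t := lt_of_lt_of_le (by positivity) ht.1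
    exact (hinit t ht).trans_lt (mul_lt_mul_of_pos_right hMN (Real.rpow_pos_of_pos ht0 c))

/-- Freeze the horizon `T'`: with `R(t) = S(t) t ^ (-c)` almost increasing, on `[T, T']` the forcing
is at most a constant times `R(T') t ^ c`. The power bound, whose constant depends neither on `T'`
nor on `M`, read at the endpoint gives a multiple of `R(T') T' ^ c = S(T')`. -/
lemma IsDrivenPantograph.eventually_abs_le {a b q A B c : ℝ} {v w S : ℝ → ℝ}
    (hw : IsDrivenPantograph a b q A B v w) (hq0 : 0 < q) (hq1 : q < 1) (hb : b < 0)
    (hc : |a| * q ^ c < -b) (hS : ∀ t, 0 < S t) (hSc : AlmostIncreasing S c)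
    (hv : ∀ᶠ t in atTop, |v t| ≤ S t) :
    ∃ K : ℝ, ∀ᶠ t in atTop, |w t| ≤ K * S t := by
  obtain ⟨T₀, K, -, hK, key⟩ := exists_pantograph_rpow_bound hq0 hq1 hb hc
  obtain ⟨T₁, C, hT₁, hC, hinc⟩ := hSc
  obtain ⟨T₂, hT₂⟩ := eventually_atTop.1 hv
  obtain ⟨T, hT⟩ : ∃ T, T = max T₀ (max T₁ T₂ / q) := ⟨_, rfl⟩
  have hTT₀ : T₀ ≤ T := hT ▸ le_max_left _ _
  have hmax : max T₁ T₂ ≤ q * T := by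
    have : max T₁ T₂ / q ≤ T := hT ▸ le_max_right _ _
    rw [div_le_iff₀ hq0] at this
    linarith
  have hqT₁ : T₁ ≤ q * T := (le_max_left _ _).trans hmax
  have hqT₂ : T₂ ≤ q * T := (le_max_right _ _).trans hmax
  have hqT : 0 < q * T := hT₁.trans_le hqT₁
  have hT0 : 0 < T := pos_of_mul_pos_right hqT hq0.le
  have hqTT : q * T ≤ T := by nlinarith
  obtain ⟨R, hR⟩ : ∃ R : ℝ → ℝ, R = fun t => S t * t ^ (-c) := ⟨_, rfl⟩
  have hRpos : ∀ t, 0 < t → 0 < R t := fun t ht => by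
    rw [hR]; exact mul_pos (hS t) (Real.rpow_pos_of_pos ht _)
  have hSR : ∀ t, 0 < t → S t = R t * t ^ c := fun t ht => by
    rw [hR]; simp only
    rw [mul_assoc, ← Real.rpow_add ht]; simp
  have hRinc : ∀ u t, T₁ ≤ u → u ≤ t → R u ≤ C * R t := fun u t h1 h2 => by
    rw [hR]; exact hinc u t h1 h2
  have hcont : ContinuousOn (fun t => |w t| * t ^ (-c)) (Icc (q * T) T) := by
    refine ContinuousOn.mul ?_ ?_
    · exact (ContinuousOn.mono (fun t ht => (hw t ht).continuousWithinAt)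
        (fun t ht => hqT.le.trans ht.1 : Icc (q * T) T ⊆ Ici 0)).abs
    · exact fun t ht => (Real.continuousAt_rpow_const t (-c)
        (Or.inl (hqT.trans_le ht.1).ne')).continuousWithinAt
  obtain ⟨K₀, hK₀⟩ := isCompact_Icc.bddAbove_image hcont
  have hK₀' : ∀ t ∈ Icc (q * T) T, |w t| ≤ |K₀| * t ^ c := fun t ht => by
    have ht0 : 0 < t := hqT.trans_le ht.1
    have h1 : |w t| * t ^ (-c) ≤ |K₀| := (hK₀ (mem_image_of_mem _ ht)).trans (le_abs_self _)
    calc |w t| = |w t| * t ^ (-c) * t ^ c := by rw [mul_assoc, ← Real.rpow_add ht0]; simp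
      _ ≤ |K₀| * t ^ c := mul_le_mul_of_nonneg_right h1 (Real.rpow_nonneg ht0.le _)
  have hRT := hRpos _ hqT
  have hqc : 0 < q ^ c := Real.rpow_pos_of_pos hq0 c
  -- The first two terms absorb the forcing, the third absorbs the initial segment `[q T, T]`
  -- through `R(q T) ≤ C R(T')`, and the `1` ensures positivity.
  obtain ⟨P, hP⟩ : ∃ P, P = |A| * q ^ c + |B| + |K₀| / R (q * T) + 1 := ⟨_, rfl⟩
  have hA : 0 ≤ |A| * q ^ c := by positivity
  have hKR : 0 ≤ |K₀| / R (q * T) := by positivity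
  have hB := abs_nonneg B
  have hP0 : 0 < P := by linarith
  refine ⟨K * (P * C), ?_⟩
  filter_upwards [eventually_ge_atTop T] with T' hT'
  have hT'0 : 0 < T' := hT0.trans_le hT'
  have hRT' := hRpos _ hT'0
  have hCR : 0 < C * R T' := by positivity
  have := key (fun t => A * v (q * t) + B * v t) w T T' (P * (C * R T')) hTT₀ hT' (by positivity)
    hw ?_ ?_
  · rw [hSR T' hT'0]
    calc _ ≤ _ := this
      _ = _ := by ring
  · intro t ht
    have ht0 : 0 < t := hT0.trans_le ht.1
    have hqt : q * T ≤ q * t := mul_le_mul_of_nonneg_left ht.1 hq0.le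
    have htc := Real.rpow_pos_of_pos ht0 c
    have e1 : |v (q * t)| ≤ C * R T' * (q ^ c * t ^ c) := by
      have := hT₂ (q * t) (hqT₂.trans hqt)
      rw [hSR _ (hqT.trans_le hqt), Real.mul_rpow hq0.le ht0.le] at this
      exact this.trans (mul_le_mul_of_nonneg_right
        (hRinc _ _ (hqT₁.trans hqt) (by nlinarith [ht.2])) (by positivity))
    have e2 : |v t| ≤ C * R T' * t ^ c := by
      have := hT₂ t (hqT₂.trans (hqTT.trans ht.1))
      rw [hSR _ ht0] at this
      exact this.trans (mul_le_mul_of_nonneg_right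
        (hRinc _ _ (hqT₁.trans (hqTT.trans ht.1)) ht.2) htc.le)
    calc |A * v (q * t) + B * v t| ≤ |A| * |v (q * t)| + |B| * |v t| := by
          rw [← abs_mul, ← abs_mul]; exact abs_add_le _ _
      _ ≤ |A| * (C * R T' * (q ^ c * t ^ c)) + |B| * (C * R T' * t ^ c) := by gcongr
      _ = (|A| * q ^ c + |B|) * (C * R T' * t ^ c) := by ring
      _ ≤ P * (C * R T' * t ^ c) :=
          mul_le_mul_of_nonneg_right (by linarith) (by positivity)
      _ = _ := by ring
  · intro t ht
    have ht0 : 0 < t := hqT.trans_le ht.1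
    refine (hK₀' t ht).trans (mul_le_mul_of_nonneg_right ?_ (Real.rpow_nonneg ht0.le _))
    have h1 : R (q * T) ≤ C * R T' := hRinc _ _ hqT₁ (hqTT.trans hT')
    calc |K₀| = |K₀| / R (q * T) * R (q * T) := by field_simp
      _ ≤ |K₀| / R (q * T) * (C * R T') := mul_le_mul_of_nonneg_left h1 hKR
      _ ≤ P * (C * R T') := mul_le_mul_of_nonneg_right (by linarith) hCR.le

/-! ### Logarithmic upper limits as exponential bounds. -/

lemma log_ofReal_abs_div_le_iff {r W p : ℝ} (hW : 0 < W) :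
    ENNReal.log (ENNReal.ofReal |r|) / (W : EReal) ≤ (p : EReal) ↔ |r| ≤ Real.exp (p * W) := by
  rw [EReal.div_le_iff_le_mul (by exact_mod_cast hW) (EReal.coe_ne_top W), ← EReal.coe_mul,
    mul_comm W p]
  have : ((p * W : ℝ) : EReal) = ENNReal.log (ENNReal.ofReal (Real.exp (p * W))) := by
    rw [ENNReal.log_ofReal_of_pos (Real.exp_pos _), Real.log_exp]
  rw [this, ENNReal.log_le_log_iff, ENNReal.ofReal_le_ofReal_iff (Real.exp_pos _).le]

lemma logLimsup_le_coe_iff {v W : ℝ → ℝ} (hW : Tendsto W atTop atTop) (p : ℝ) :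
    logLimsup v W ≤ p ↔ ∀ p' > p, ∀ᶠ t in atTop, |v t| ≤ Real.exp (p' * W t) := by
  rw [logLimsup, limsup_le_iff']
  have hpos := hW.eventually_gt_atTop 0
  constructor
  · intro h p' hp'
    filter_upwards [h p' (by exact_mod_cast hp'), hpos] with t h1 h2
    exact (log_ofReal_abs_div_le_iff h2).1 h1
  · intro h z hz
    obtain ⟨p', hp, hz'⟩ := EReal.lt_iff_exists_real_btwn.1 hz
    filter_upwards [h p' (by exact_mod_cast hp), hpos] with t h1 h2
    exact ((log_ofReal_abs_div_le_iff h2).2 h1).trans hz'.le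

lemma logLimsup_le_coe_of_const_mul {v W : ℝ → ℝ} (hW : Tendsto W atTop atTop) {p : ℝ}
    (h : ∀ p' > p, ∃ K : ℝ, ∀ᶠ t in atTop, |v t| ≤ K * Real.exp (p' * W t)) :
    logLimsup v W ≤ p := by
  rw [logLimsup_le_coe_iff hW]
  intro p' hp'
  obtain ⟨K, hK⟩ := h ((p + p') / 2) (by linarith)
  -- Half of the gap `p' - p` is spent on beating the constant `K`.
  have hgrow : Tendsto (fun t => Real.exp ((p' - p) / 2 * W t)) atTop atTop :=
    Real.tendsto_exp_atTop.comp (hW.const_mul_atTop (by linarith))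
  filter_upwards [hK, hgrow.eventually_ge_atTop K] with t h1 h2
  calc |v t| ≤ K * Real.exp ((p + p') / 2 * W t) := h1
    _ ≤ Real.exp ((p' - p) / 2 * W t) * Real.exp ((p + p') / 2 * W t) :=
        mul_le_mul_of_nonneg_right h2 (Real.exp_pos _).le
    _ = Real.exp (p' * W t) := by rw [← Real.exp_add]; ring_nf

lemma logLimsup_le_iff_of_tendsto_div {v W₁ W₂ : ℝ → ℝ} {ρ : ℝ} (hρ : 0 < ρ)
    (h₁ : Tendsto W₁ atTop atTop) (h₂ : Tendsto W₂ atTop atTop)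
    (h : Tendsto (fun t => W₁ t / W₂ t) atTop (𝓝 ρ)) (p : ℝ) :
    logLimsup v W₁ ≤ p ↔ logLimsup v W₂ ≤ ((p * ρ : ℝ) : EReal) := by
  rw [logLimsup_le_coe_iff h₁, logLimsup_le_coe_iff h₂]
  have hpos := h₂.eventually_gt_atTop 0
  constructor
  · intro hv p' hp'
    obtain ⟨r, hr1, hr2⟩ := exists_between ((lt_div_iff₀ hρ).2 hp')
    have hlt : r * ρ < p' := (lt_div_iff₀ hρ).1 hr2
    filter_upwards [hv r hr1, hpos, (h.const_mul r).eventually_lt_const hlt] with t e1 e2 e3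
    refine e1.trans (Real.exp_le_exp.2 ?_)
    rw [← mul_div_assoc, div_lt_iff₀ e2] at e3
    exact e3.le
  · intro hv p' hp'
    obtain ⟨r, hr1, hr2⟩ := exists_between (mul_lt_mul_of_pos_right hp' hρ)
    filter_upwards [hv r hr1, hpos, (h.const_mul p').eventually_const_lt hr2] with t e1 e2 e3
    refine e1.trans (Real.exp_le_exp.2 ?_)
    rw [← mul_div_assoc, lt_div_iff₀ e2] at e3
    exact e3.le

lemma EReal.eq_coe_iff_of_forall_le_iff {X Y : EReal} {p₀ L : ℝ} (hL : p₀ < L)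
    (h : ∀ p : ℝ, p₀ < p → (X ≤ p ↔ Y ≤ p)) : X = L ↔ Y = L := by
  have key : ∀ {X Y : EReal}, (∀ p : ℝ, p₀ < p → (X ≤ p ↔ Y ≤ p)) → X = L → Y = L := by
    intro X Y h hX
    refine le_antisymm ((h L hL).1 hX.le) (not_lt.1 fun hlt => ?_)
    obtain ⟨r, hr1, hr2⟩ := EReal.lt_iff_exists_real_btwn.1 hlt
    have hr2' : r < L := by exact_mod_cast hr2
    -- The midpoint keeps the tested level above `p₀`, where the equivalence is available, and still
    -- below `L`.
    have hm : max r ((p₀ + L) / 2) < L := max_lt hr2' (by linarith)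
    have hYm : Y ≤ ((max r ((p₀ + L) / 2) : ℝ) : EReal) :=
      hr1.le.trans (by exact_mod_cast le_max_left _ _)
    have := (h _ (lt_of_lt_of_le (by linarith) (le_max_right r ((p₀ + L) / 2)))).2 hYm
    rw [hX] at this
    exact absurd (by exact_mod_cast this) (not_le.2 hm)
  exact ⟨key h, key fun p hp => (h p hp).symm⟩

lemma EReal.le_coe_iff_of_forall_le_iff {X Y : EReal} {p₀ : ℝ}
    (h : ∀ p : ℝ, p₀ < p → (X ≤ p ↔ Y ≤ p)) : X ≤ p₀ ↔ Y ≤ p₀ := by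
  rw [← EReal.le_of_forall_lt_iff_le, ← EReal.le_of_forall_lt_iff_le]
  exact forall_congr' fun p => forall_congr' fun hp => h p (by exact_mod_cast hp)

lemma logLimsup_eq_iff_of_tendsto_div {v W₁ W₂ : ℝ → ℝ} {ρ : ℝ} (hρ : 0 < ρ)
    (h₁ : Tendsto W₁ atTop atTop) (h₂ : Tendsto W₂ atTop atTop)
    (h : Tendsto (fun t => W₁ t / W₂ t) atTop (𝓝 ρ)) (p : ℝ) :
    logLimsup v W₁ = p ↔ logLimsup v W₂ = ((p * ρ : ℝ) : EReal) := by
  have hle := logLimsup_le_iff_of_tendsto_div (v := v) hρ h₁ h₂ h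
  constructor
  · intro e
    refine le_antisymm ((hle p).1 e.le) (EReal.ge_of_forall_gt_iff_ge.1 fun r hr => ?_)
    have hr' : r < p * ρ := by exact_mod_cast hr
    by_contra! hlt
    have h1 := (hle (r / ρ)).2 (by rw [div_mul_cancel₀ _ hρ.ne']; exact hlt.le)
    rw [e] at h1
    have h2 : p ≤ r / ρ := by exact_mod_cast h1
    rw [le_div_iff₀ hρ] at h2
    linarith
  · intro e
    refine le_antisymm ((hle p).2 e.le) (EReal.ge_of_forall_gt_iff_ge.1 fun r hr => ?_)
    have hr' : r < p := by exact_mod_cast hr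
    by_contra! hlt
    have h1 := (hle r).1 hlt.le
    rw [e] at h1
    have h2 : p * ρ ≤ r * ρ := by exact_mod_cast h1
    nlinarith

/-! ### Transfer of growth bounds between `x` and `y`. -/

section Transfer

variable {a b q : ℝ} {f x y : ℝ → ℝ}

lemma IsPantographSolution.sub_auxiliary (hx : IsPantographSolution a b q f x)
    (hy : IsAuxiliarySolution f y) :
    IsDrivenPantograph a b q a (1 + b) y (fun t => x t - y t) := fun t ht => by
  refine ((hx t ht).fun_sub (hy.2 t ht)).congr_deriv ?_
  ring

/-- With delay coefficient `0` and damping `-1`, the condition on the exponent `c` reads `0 < 1`, so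
every `c` is allowed in this direction. -/
lemma IsAuxiliarySolution.sub_pantograph (hy : IsAuxiliarySolution f y)
    (hx : IsPantographSolution a b q f x) :
    IsDrivenPantograph 0 (-1) q (-a) (-(1 + b)) x (fun t => y t - x t) := fun t ht => by
  refine ((hy.2 t ht).fun_sub (hx t ht)).congr_deriv ?_
  ring

lemma eventually_abs_le_of_sub {x y S : ℝ → ℝ}
    (hd : ∃ K : ℝ, ∀ᶠ t in atTop, |x t - y t| ≤ K * S t) (hy : ∀ᶠ t in atTop, |y t| ≤ S t) :
    ∃ K : ℝ, ∀ᶠ t in atTop, |x t| ≤ K * S t := by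
  obtain ⟨K, hK⟩ := hd
  refine ⟨K + 1, ?_⟩
  filter_upwards [hK, hy] with t h1 h2
  have := abs_add_le (x t - y t) (y t)
  rw [sub_add_cancel] at this
  linarith

/-- If the weights `exp (p W)`, `p > p₀`, are comparable to powers above the critical one, the
logarithmic growth bounds of `y` and `x` agree. -/
lemma logLimsup_le_iff_of_almostIncreasing (hq0 : 0 < q) (hq1 : q < 1) (hb : b < 0)
    (hx : IsPantographSolution a b q f x) (hy : IsAuxiliarySolution f y) {W : ℝ → ℝ} {p₀ : ℝ}
    (hW : Tendsto W atTop atTop)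
    (hS : ∀ p > p₀, ∃ c : ℝ, |a| * q ^ c < -b ∧ AlmostIncreasing (fun t => Real.exp (p * W t)) c)
    (p : ℝ) (hp : p₀ < p) : logLimsup y W ≤ p ↔ logLimsup x W ≤ p := by
  constructor
  · intro h
    refine logLimsup_le_coe_of_const_mul hW fun p' hp' => ?_
    obtain ⟨c, hc, hSc⟩ := hS p' (hp.trans hp')
    have hb' := (logLimsup_le_coe_iff hW p).1 h p' hp'
    exact eventually_abs_le_of_sub ((hx.sub_auxiliary hy).eventually_abs_le hq0 hq1 hb hc
      (fun t => Real.exp_pos _) hSc hb') hb'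
  · intro h
    refine logLimsup_le_coe_of_const_mul hW fun p' hp' => ?_
    obtain ⟨c, -, hSc⟩ := hS p' (hp.trans hp')
    have hb' := (logLimsup_le_coe_iff hW p).1 h p' hp'
    exact eventually_abs_le_of_sub ((hy.sub_pantograph hx).eventually_abs_le hq0 hq1 (by norm_num)
      (by simp) (fun t => Real.exp_pos _) hSc hb') hb'

end Transfer

/-! ### Admissible weights and the critical exponent. -/

lemma almostIncreasing_exp_log (p : ℝ) :
    AlmostIncreasing (fun t => Real.exp (p * Real.log t)) p := by
  refine ⟨1, 1, one_pos, one_pos, fun u t hu hut => ?_⟩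
  have h : ∀ s : ℝ, 1 ≤ s → Real.exp (p * Real.log s) * s ^ (-p) = 1 := fun s hs => by
    rw [Real.rpow_def_of_pos (by linarith), ← Real.exp_add]
    simp [mul_comm]
  rw [h u hu, h t (hu.trans hut), one_mul]

lemma almostIncreasing_exp_of_monotoneOn {W : ℝ → ℝ} {t₀ p : ℝ} (hW : MonotoneOn W (Ici t₀))
    (hp : 0 ≤ p) : AlmostIncreasing (fun t => Real.exp (p * W t)) 0 := by
  refine ⟨max t₀ 1, 1, by positivity, one_pos, fun u t hu hut => ?_⟩
  have hu' : t₀ ≤ u := (le_max_left _ _).trans hu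
  simpa using mul_le_mul_of_nonneg_left (hW hu' (hu'.trans hut) hut) hp

/-- A Potter-type bound. -/
lemma sub_le_mul_log_add_of_sub_le {W : ℝ → ℝ} {q T ε : ℝ} (hq0 : 0 < q) (hq1 : q < 1)
    (hT : 0 < T) (hε : 0 ≤ ε) (hW : MonotoneOn W (Ici (q * T)))
    (h : ∀ t, T ≤ t → W t - W (q * t) ≤ ε) {u t : ℝ} (hu : T ≤ u) (hut : u ≤ t) :
    W t - W u ≤ ε * (Real.log (t / u) / Real.log (1 / q) + 1) := by
  have hu0 : 0 < u := hT.trans_le hu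
  have hlq : 0 < Real.log (1 / q) := Real.log_pos (by rw [lt_div_iff₀ hq0]; linarith)
  have key : ∀ n : ℕ, ∀ t, u ≤ t → q ^ n * t ≤ u → W t - W u ≤ ε * n := by
    intro n
    induction n with
    | zero =>
      intro t h1 h2
      have : t = u := le_antisymm (by simpa using h2) h1
      simp [this]
    | succ n ih =>
      intro t h1 h2
      have hTt : T ≤ t := hu.trans h1
      have h3 := h t hTt
      -- If `q * t` drops below `u`, monotonicity gives `W (q * t) ≤ W u` and a single step of cost
      -- `ε` suffices.
      rcases le_total u (q * t) with h4 | h4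
      · have := ih (q * t) h4 (by rw [pow_succ] at h2; linarith)
        push_cast; linarith
      · have : W (q * t) ≤ W u := hW (mem_Ici.2 (mul_le_mul_of_nonneg_left hTt hq0.le))
          (mem_Ici.2 (by nlinarith)) h4
        have h5 : 0 ≤ ε * n := by positivity
        push_cast; linarith
  have hlog : 0 ≤ Real.log (t / u) := Real.log_nonneg ((one_le_div hu0).2 hut)
  have hr : 0 ≤ Real.log (t / u) / Real.log (1 / q) := by positivity
  obtain ⟨n, hn⟩ : ∃ n, n = ⌈Real.log (t / u) / Real.log (1 / q)⌉₊ := ⟨_, rfl⟩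
  have hn1 : Real.log (t / u) / Real.log (1 / q) ≤ n := hn ▸ Nat.le_ceil _
  have hn2 : (n : ℝ) ≤ Real.log (t / u) / Real.log (1 / q) + 1 :=
    hn ▸ (Nat.ceil_lt_add_one hr).le
  refine (key n t hut ?_).trans (mul_le_mul_of_nonneg_left hn2 hε)
  rw [div_le_iff₀ hlq, ← Real.log_pow, Real.log_le_log_iff (div_pos (hu0.trans_le hut) hu0)
    (by positivity), div_le_iff₀ hu0, one_div, inv_pow] at hn1
  have hqn : 0 < q ^ n := pow_pos hq0 n
  calc q ^ n * t ≤ q ^ n * ((q ^ n)⁻¹ * u) := mul_le_mul_of_nonneg_left hn1 hqn.le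
    _ = u := by field_simp

/-- By the Potter bound, `exp (p W)` decreases at most like an arbitrarily small negative power,
whatever the sign and size of `p`. -/
lemma almostIncreasing_exp_of_tendsto_sub {W : ℝ → ℝ} {q t₀ ε : ℝ} (hq0 : 0 < q) (hq1 : q < 1)
    (hε : 0 < ε) (hW : MonotoneOn W (Ici t₀))
    (h : Tendsto (fun t => W t - W (q * t)) atTop (𝓝 0)) (p : ℝ) :
    AlmostIncreasing (fun t => Real.exp (p * W t)) (-ε) := by
  have hlq : 0 < Real.log (1 / q) := Real.log_pos (by rw [lt_div_iff₀ hq0]; linarith)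
  -- Chosen so that `|p| * δ / log (1 / q) ≤ ε`; the `+ 1` covers `p = 0`.
  obtain ⟨δ, hδ⟩ : ∃ δ, δ = ε * Real.log (1 / q) / (|p| + 1) := ⟨_, rfl⟩
  have hδ0 : 0 < δ := by rw [hδ]; positivity
  obtain ⟨T₁, hT₁⟩ := eventually_atTop.1 (h.eventually_le_const hδ0)
  obtain ⟨T, hT⟩ : ∃ T, T = max T₁ (max t₀ 1 / q) := ⟨_, rfl⟩
  have hT1 : T₁ ≤ T := hT ▸ le_max_left _ _
  have hT2 : max t₀ 1 ≤ q * T := by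
    have : max t₀ 1 / q ≤ T := hT ▸ le_max_right _ _
    rw [div_le_iff₀ hq0] at this
    linarith
  have hqT : 0 < q * T := lt_of_lt_of_le (by positivity) hT2
  have hT0 : 0 < T := pos_of_mul_pos_right hqT hq0.le
  have hmono : MonotoneOn W (Ici (q * T)) :=
    hW.mono (Ici_subset_Ici.2 ((le_max_left _ _).trans hT2))
  refine ⟨T, Real.exp (|p| * δ), hT0, Real.exp_pos _, fun u t hu hut => ?_⟩
  have hu0 : 0 < u := hT0.trans_le hu
  have ht0 : 0 < t := hu0.trans_le hut
  have hpot := sub_le_mul_log_add_of_sub_le hq0 hq1 hT0 hδ0.le hmono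
    (fun t ht => hT₁ t (hT1.trans ht)) hu hut
  have hWut : W u ≤ W t := hmono (mem_Ici.2 (by nlinarith)) (mem_Ici.2 (by nlinarith)) hut
  rw [Real.rpow_def_of_pos hu0, Real.rpow_def_of_pos ht0, ← Real.exp_add, ← Real.exp_add,
    ← Real.exp_add, Real.exp_le_exp, neg_neg]
  have hlog : Real.log (t / u) = Real.log t - Real.log u := Real.log_div ht0.ne' hu0.ne'
  have hlog0 : 0 ≤ Real.log (t / u) := Real.log_nonneg ((one_le_div hu0).2 hut)
  have h1 : p * W u - p * W t ≤ |p| * (W t - W u) := by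
    have := mul_le_mul_of_nonneg_right (neg_abs_le p) (sub_nonneg.2 hWut)
    linarith
  have h2 : |p| * (W t - W u) ≤ |p| * (δ * (Real.log (t / u) / Real.log (1 / q) + 1)) :=
    mul_le_mul_of_nonneg_left hpot (abs_nonneg p)
  have h3 : |p| * (δ * (Real.log (t / u) / Real.log (1 / q))) ≤ ε * Real.log (t / u) := by
    have : |p| * (δ * (Real.log (t / u) / Real.log (1 / q))) =
        |p| / (|p| + 1) * (ε * Real.log (t / u)) := by
      rw [hδ]; field_simp
    rw [this]
    refine mul_le_of_le_one_left (by positivity) ?_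
    rw [div_le_one (by positivity)]
    linarith
  rw [hlog] at h2 h3
  nlinarith

/-- The exponent `κ` is the root of `|a| q ^ κ = |b|`, and `q ^ c` decreases in `c`. -/
lemma abs_mul_rpow_lt_of_pantographKappa_lt {a b q c : ℝ} (ha : a ≠ 0) (hb : b < 0) (hq0 : 0 < q)
    (hq1 : q < 1) (hc : pantographKappa a b q < c) : |a| * q ^ c < -b := by
  have hlq : 0 < Real.log (1 / q) := Real.log_pos (by rw [lt_div_iff₀ hq0]; linarith)
  have hA : 0 < |a| := abs_pos.2 ha
  rw [pantographKappa, div_lt_iff₀ hlq, one_div, Real.log_inv, abs_div, abs_of_neg hb,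
    Real.log_div (by linarith) hA.ne'] at hc
  rw [← Real.log_lt_log_iff (by positivity) (by linarith), Real.log_mul hA.ne' (by positivity),
    Real.log_rpow hq0]
  linarith

lemma pantographKappa_neg {a b q : ℝ} (ha : a ≠ 0) (hab : |a| < |b|) (hq0 : 0 < q)
    (hq1 : q < 1) : pantographKappa a b q < 0 := by
  have hlq : 0 < Real.log (1 / q) := Real.log_pos (by rw [lt_div_iff₀ hq0]; linarith)
  have : 0 < Real.log |b / a| := Real.log_pos (by
    rw [abs_div, lt_div_iff₀ (abs_pos.2 ha)]; linarith)
  exact div_neg_of_neg_of_pos (by linarith) hlq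

lemma IsSlowlyVarying.tendsto_sub {W : ℝ → ℝ} {q : ℝ} (hq0 : 0 < q)
    (h : IsSlowlyVarying fun t => Real.exp (-W t)) :
    Tendsto (fun t => W t - W (q * t)) atTop (𝓝 0) := by
  have := (h.2 q hq0).log one_ne_zero
  rw [Real.log_one] at this
  refine this.congr fun t => ?_
  rw [← Real.exp_sub, Real.log_exp]
  ring

lemma IsSlowlyVarying.congr {g h : ℝ → ℝ} (hg : IsSlowlyVarying g) (hgh : g =ᶠ[atTop] h) :
    IsSlowlyVarying h := by
  refine ⟨?_, fun c hc => (hg.2 c hc).congr' ?_⟩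
  · filter_upwards [hg.1, hgh] with t h1 h2
    rwa [← h2]
  · filter_upwards [(tendsto_id.const_mul_atTop hc).eventually hgh, hgh] with t h1 h2
    simp only [id] at h1
    rw [h1, h2]

theorem mainTheorem9
    (a b q : ℝ) (ha : a ≠ 0) (hb : b < 0) (hab : |a| < |b|) (hq0 : 0 < q) (hq1 : q < 1)
    (f : ℝ → ℝ) (hf : ContinuousOn f (Ici 0))
    (x : ℝ → ℝ) (hx : IsPantographSolution a b q f x)
    (y : ℝ → ℝ) (hy : IsAuxiliarySolution f y)
    (θ : ℝ → ℝ) (hθ_mono : ∃ t₀ : ℝ, MonotoneOn (fun t => |θ t|) (Ici t₀))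
    (hθ_top : Tendsto (fun t => |θ t|) atTop atTop)
    (η : EReal) (hκη : ((pantographKappa a b q : ℝ) : EReal) ≤ η)
    (hη : Tendsto (fun t => ((θ t / Real.log t : ℝ) : EReal)) atTop (𝓝 η)) :
    -- (A)
    (η = ((pantographKappa a b q : ℝ) : EReal) →
      (logLimsup y (fun t => |θ t|) ≤ -1 ↔ logLimsup x (fun t => |θ t|) ≤ -1) ∧
      (logLimsup y Real.log ≤ η ↔ logLimsup x Real.log ≤ η)) ∧
    -- (B)
    (((pantographKappa a b q : ℝ) : EReal) < η →
      (Tendsto θ atTop atTop → (logLimsup y θ = 1 ↔ logLimsup x θ = 1)) ∧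
      (Tendsto θ atTop atBot → (η = 0 → IsSlowlyVarying (fun t => Real.exp (θ t))) →
        (logLimsup y (fun t => |θ t|) = -1 ↔ logLimsup x (fun t => |θ t|) = -1)) ∧
      (η ≠ ⊤ → (logLimsup y Real.log = η ↔ logLimsup x Real.log = η))) := by
  have hκ := pantographKappa_neg ha hab hq0 hq1 (b := b)
  set κ := pantographKappa a b q with hκdef
  have hexp : ∀ c, κ < c → |a| * q ^ c < -b := fun c hc =>
    abs_mul_rpow_lt_of_pantographKappa_lt ha hb hq0 hq1 hc
  have hexp0 : |a| * q ^ (0 : ℝ) < -b := hexp 0 hκ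
  have hlog := Real.tendsto_log_atTop
  have hLog : ∀ p : ℝ, κ < p → (logLimsup y Real.log ≤ p ↔ logLimsup x Real.log ≤ p) :=
    logLimsup_le_iff_of_almostIncreasing hq0 hq1 hb hx hy hlog
      fun p hp => ⟨p, hexp p hp, almostIncreasing_exp_log p⟩
  obtain ⟨t₀, ht₀⟩ := hθ_mono
  have hratio : ∀ r : ℝ, r < 0 → η = r →
      Tendsto (fun t => |θ t| / Real.log t) atTop (𝓝 (-r)) := by
    intro r hr hηr
    rw [hηr] at hη
    have h := (EReal.tendsto_coe.1 hη).abs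
    rw [abs_of_neg hr] at h
    refine h.congr' ?_
    filter_upwards [eventually_ge_atTop 1] with t ht
    rw [abs_div, abs_of_nonneg (Real.log_nonneg ht)]
  refine ⟨fun hηκ => ?_, fun hκη' => ⟨fun hθ => ?_, fun hθ hslow => ?_, fun hηtop => ?_⟩⟩
  · have hle : logLimsup y Real.log ≤ κ ↔ logLimsup x Real.log ≤ κ :=
      EReal.le_coe_iff_of_forall_le_iff hLog
    refine ⟨?_, by rw [hηκ]; exact hle⟩
    -- Here `|θ| ~ -κ log t`, so level `-1` for `|θ|` is level `κ` for `log`.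
    have hconv : ∀ v : ℝ → ℝ, logLimsup v (fun t => |θ t|) ≤ -1 ↔ logLimsup v Real.log ≤ κ := by
      intro v
      simpa using logLimsup_le_iff_of_tendsto_div (v := v) (neg_pos.2 hκ) hθ_top hlog
        (hratio κ hκ hηκ) (-1)
    rw [hconv, hconv, hle]
  · have hmono : ∃ t₁, MonotoneOn θ (Ici t₁) := by
      obtain ⟨t₁, ht₁⟩ := eventually_atTop.1 (hθ.eventually_ge_atTop 0)
      refine ⟨max t₀ t₁, fun u hu t ht hut => ?_⟩
      have hu' := max_le_iff.1 (mem_Ici.1 hu)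
      have ht' := max_le_iff.1 (mem_Ici.1 ht)
      have := ht₀ (mem_Ici.2 hu'.1) (mem_Ici.2 ht'.1) hut
      simpa only [abs_of_nonneg (ht₁ u hu'.2), abs_of_nonneg (ht₁ t ht'.2)] using this
    obtain ⟨t₁, ht₁⟩ := hmono
    -- Threshold `0`: for `p > 0` the weight `exp (p θ)` is itself increasing, and `c = 0` is
    -- admissible because `κ < 0`.
    exact_mod_cast EReal.eq_coe_iff_of_forall_le_iff one_pos
      (logLimsup_le_iff_of_almostIncreasing hq0 hq1 hb hx hy hθ
        fun p hp => ⟨0, hexp0, almostIncreasing_exp_of_monotoneOn ht₁ hp.le⟩)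
  · have hη0 : η ≤ 0 := by
      refine le_of_tendsto hη ?_
      filter_upwards [hθ.eventually_le_atBot 0, eventually_ge_atTop 1] with t h1 h2
      exact_mod_cast div_nonpos_of_nonpos_of_nonneg h1 (Real.log_nonneg h2)
    rcases hη0.eq_or_lt with h0 | h0
    · have habs : (fun t => Real.exp (θ t)) =ᶠ[atTop] fun t => Real.exp (-|θ t|) := by
        filter_upwards [hθ.eventually_le_atBot 0] with t ht
        rw [abs_of_nonpos ht, neg_neg]
      have hsub := ((hslow h0).congr habs).tendsto_sub hq0
      -- Any threshold below `-1` would do, since slow variation handles every `p`. The exponent is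
      -- `c = κ / 2`, strictly between `κ` and `0`.
      have := EReal.eq_coe_iff_of_forall_le_iff (L := -1) (p₀ := -2) (by norm_num)
        (logLimsup_le_iff_of_almostIncreasing hq0 hq1 hb hx hy hθ_top fun p _ =>
          ⟨-(-κ / 2), hexp _ (by linarith),
            almostIncreasing_exp_of_tendsto_sub hq0 hq1 (by linarith) ht₀ hsub p⟩)
      simpa using this
    · lift η to ℝ using ⟨(h0.trans EReal.zero_lt_top).ne, (bot_le.trans_lt hκη').ne'⟩
      have hηneg : η < 0 := by exact_mod_cast h0
      -- For `κ < η < 0` the weight `|θ|` is asymptotic to `-η log t`, so the claim becomes the one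
      -- for `log` at level `η`.
      have hconv : ∀ v : ℝ → ℝ,
          logLimsup v (fun t => |θ t|) = -1 ↔ logLimsup v Real.log = η := by
        intro v
        simpa using logLimsup_eq_iff_of_tendsto_div (v := v) (neg_pos.2 hηneg) hθ_top hlog
          (hratio η hηneg rfl) (-1)
      rw [hconv, hconv]
      exact EReal.eq_coe_iff_of_forall_le_iff (by exact_mod_cast hκη') hLog
  · lift η to ℝ using ⟨hηtop, (bot_le.trans_lt hκη').ne'⟩
    exact EReal.eq_coe_iff_of_forall_le_iff (by exact_mod_cast hκη') hLog
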